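/- Let $\mathbb{S}^1=\mathbb{R}/2\pi\mathbb{Z}$ with Lebesgue measure, let $m\ge 2$ be an integer, and let $\mathcal{A}=(-\Delta)^m$ be the $m$-th power of the self-adjoint operator $-\Delta=-\partial_{xx}$ on $L^2(\mathbb{S}^1)$ with domain $H^2(\mathbb{S}^1)$. Let $L_{\mathcal{A}}=\mathcal{A}+\partial_{tt}$ be the self-adjoint operator on $L^2(\mathbb{S}^1\times\mathbb{S}^1)$ defined by eigenfunction expansion: if $(\zeta_k)_k$ is an orthonormal basis of $L^2(\mathbb{S}^1)$ with $\mathcal{A}\zeta_k=\nu_k\zeta_k$ and $e_l(t)=e^{ilt}$ for $l\in\mathbb{Z}$, then the domain of $L_{\mathcal{A}}$ consists of all $v=\sum_{k,l}a_{kl}\,\zeta_k\otimes e_l\in L^2(\mathbb{S}^1\times\mathbb{S}^1)$ such that $\sum_{k,l}(\nu_k-l^2)^2|a_{kl}|^2<\infty$, and $L_{\mathcal{A}}v=\sum_{k,l}(\nu_k-l^2)\,a_{kl}\,\zeta_k\otimes e_l$. (This does not depend on the choice of the eigenbasis.) Then every nonempty open set $\Omega\subset\mathbb{S}^1\times\mathbb{S}^1$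 has the control property for $L_{\mathcal{A}}$: there is a constant $C=C(\Omega,m)>0$ such that $$\|u\|_{L^2(\mathbb{S}^1\times\mathbb{S}^1)}\le C\,\|u\|_{L^2(\Omega)}\qquad\text{for all } u\in\ker(L_{\mathcal{A}}).$$ -/

import Mathlib

open MeasureTheory
open scoped ENNReal ContDiff

noncomputable section

namespace GenWave

instance fact_two_pi_pos : Fact (0 < 2 * Real.pi) := ⟨Real.two_pi_pos⟩

/-- The circle `ℝ / 2πℤ`; its `volume` is Lebesgue measure, of total mass `2π`. -/
abbrev S1 : Type := AddCircle (2 * Real.pi)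

/-- The complex Hilbert space `L²(M, μ)`. -/
abbrev L2 {M : Type*} [MeasurableSpace M] (μ : Measure M) := Lp ℂ 2 μ

/-- Composition `g ∘ f` of unbounded operators on its natural domain
`{u ∈ D(f) : f u ∈ D(g)}`. -/
def opComp {E : Type*} [AddCommGroup E] [Module ℂ E] (g f : E →ₗ.[ℂ] E) : E →ₗ.[ℂ] E :=
  g.comp (f.domRestrict ((g.domain.comap f.toFun).map f.domain.subtype)) (by
    intro x
    obtain ⟨y, hy, hyx⟩ := Submodule.mem_map.1 (Submodule.mem_inf.1 x.2).1
    rw [LinearPMap.domRestrict_apply (x := x) (y := y) hyx.symm]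
    exact hy)

/-- Powers of an unbounded operator, each on its natural domain. -/
def opPow {E : Type*} [AddCommGroup E] [Module ℂ E] (A : E →ₗ.[ℂ] E) : ℕ → (E →ₗ.[ℂ] E)
  | 0 => (LinearMap.id : E →ₗ[ℂ] E).toPMap ⊤
  | n + 1 => opComp A (opPow A n)

/-! ### The operator `-Δ` on the circle -/

/-- Smooth functions on the circle, viewed as `2π`-periodic functions on the line. -/
def IsTestFunction (φ : ℝ → ℂ) : Prop :=
  ContDiff ℝ ∞ φ ∧ Function.Periodic φ (2 * Real.pi)

/-- `f = -u''` weakly on the circle. -/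
def IsWeakNegLaplacian (u f : L2 (volume : Measure S1)) : Prop :=
  ∀ φ : ℝ → ℂ, IsTestFunction φ →
    ∫ x in (0 : ℝ)..(2 * Real.pi), u (x : S1) * (-deriv (deriv φ) x)
      = ∫ x in (0 : ℝ)..(2 * Real.pi), f (x : S1) * φ x

lemma intervalIntegrable_mul (u : L2 (volume : Measure S1)) {ψ : ℝ → ℂ} (hψ : Continuous ψ) :
    IntervalIntegrable (fun x : ℝ => u (x : S1) * ψ x) volume 0 (2 * Real.pi) := by
  have h1 : Integrable (u : S1 → ℂ) volume :=
    (Lp.memLp u).integrable (by norm_num)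
  have hmp := AddCircle.measurePreserving_mk (2 * Real.pi) 0
  have h2 : IntegrableOn (fun x : ℝ => u (x : S1)) (Set.Ioc 0 (0 + 2 * Real.pi)) volume :=
    hmp.integrable_comp_of_integrable h1
  rw [zero_add] at h2
  have h3 : IntervalIntegrable (fun x : ℝ => u (x : S1)) volume 0 (2 * Real.pi) := by
    rwa [intervalIntegrable_iff_integrableOn_Ioc_of_le Real.two_pi_pos.le]
  exact h3.mul_continuousOn hψ.continuousOn

lemma ae_interval {p : S1 → Prop} (h : ∀ᵐ x ∂(volume : Measure S1), p x) :
    ∀ᵐ x : ℝ, x ∈ Set.uIoc 0 (2 * Real.pi) → p (x : S1) := by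
  have hmp := AddCircle.measurePreserving_mk (2 * Real.pi) 0
  rw [zero_add] at hmp
  have := hmp.quasiMeasurePreserving.ae h
  rw [Set.uIoc_of_le Real.two_pi_pos.le]
  exact (ae_restrict_iff' measurableSet_Ioc).1 this

lemma integral_add_mul (u v : L2 (volume : Measure S1)) {ψ : ℝ → ℂ} (hψ : Continuous ψ) :
    ∫ x in (0 : ℝ)..(2 * Real.pi), (u + v : L2 (volume : Measure S1)) (x : S1) * ψ x
      = (∫ x in (0 : ℝ)..(2 * Real.pi), u (x : S1) * ψ x)
        + ∫ x in (0 : ℝ)..(2 * Real.pi), v (x : S1) * ψ x := by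
  rw [← intervalIntegral.integral_add (intervalIntegrable_mul u hψ) (intervalIntegrable_mul v hψ)]
  refine intervalIntegral.integral_congr_ae ?_
  filter_upwards [ae_interval (Lp.coeFn_add u v)] with x hx hx'
  rw [hx hx', Pi.add_apply, add_mul]

lemma integral_smul_mul (c : ℂ) (u : L2 (volume : Measure S1)) (ψ : ℝ → ℂ) :
    ∫ x in (0 : ℝ)..(2 * Real.pi), (c • u : L2 (volume : Measure S1)) (x : S1) * ψ x
      = c * ∫ x in (0 : ℝ)..(2 * Real.pi), u (x : S1) * ψ x := by
  rw [← intervalIntegral.integral_const_mul]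
  refine intervalIntegral.integral_congr_ae ?_
  filter_upwards [ae_interval (Lp.coeFn_smul c u)] with x hx hx'
  rw [hx hx', Pi.smul_apply, smul_eq_mul, mul_assoc]

lemma IsTestFunction.continuous {φ : ℝ → ℂ} (h : IsTestFunction φ) : Continuous φ :=
  h.1.continuous

lemma IsTestFunction.continuous_deriv2 {φ : ℝ → ℂ} (h : IsTestFunction φ) :
    Continuous (fun x => -deriv (deriv φ) x) := by
  have h2 : ContDiff ℝ ∞ (deriv φ) := (contDiff_infty_iff_deriv.1 h.1).2
  exact ((contDiff_infty_iff_deriv.1 h2).2.continuous).neg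

/-- The graph of `-Δ` on `L²(S¹)` with domain `H²(S¹) = {u : u'' ∈ L²(S¹) weakly}`. -/
def negLaplacianGraph :
    Submodule ℂ (L2 (volume : Measure S1) × L2 (volume : Measure S1)) where
  carrier := {p | IsWeakNegLaplacian p.1 p.2}
  zero_mem' := by
    intro φ hφ
    have h (ψ : ℝ → ℂ) := integral_smul_mul 0 (0 : L2 (volume : Measure S1)) ψ
    simp only [smul_zero, zero_mul] at h
    rw [Prod.fst_zero, Prod.snd_zero, h, h]
  add_mem' := by
    intro p q hp hq φ hφ
    rw [Prod.fst_add, Prod.snd_add, integral_add_mul _ _ hφ.continuous_deriv2,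
      integral_add_mul _ _ hφ.continuous, hp φ hφ, hq φ hφ]
  smul_mem' := by
    intro c p hp φ hφ
    rw [Prod.smul_fst, Prod.smul_snd, integral_smul_mul, integral_smul_mul, hp φ hφ]

lemma isTestFunction_fourier (n : ℤ) :
    IsTestFunction (fun x : ℝ => (fourier n (x : S1) : ℂ)) := by
  refine ⟨?_, fun x => by simp⟩
  simp only [fourier_coe_apply]
  have h : ContDiff ℝ ∞ (fun x : ℝ => (x : ℂ)) := Complex.ofRealCLM.contDiff
  fun_prop

/-- The weak `-Δ` is single-valued, so that the graph above is the graph of an operator. -/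
lemma negLaplacianGraph_single_valued :
    ∀ p ∈ negLaplacianGraph, p.1 = 0 → p.2 = 0 := by
  rintro ⟨u, f⟩ hp hu
  simp only at hu ⊢
  subst hu
  have h0 (ψ : ℝ → ℂ) := integral_smul_mul 0 (0 : L2 (volume : Measure S1)) ψ
  simp only [smul_zero, zero_mul] at h0
  have hf : MemLp (f : S1 → ℂ) 2 AddCircle.haarAddCircle :=
    memLp_haarAddCircle_iff.2 (Lp.memLp f)
  have hz : hf.toLp (f : S1 → ℂ) = 0 := by
    apply (fourierBasis (T := 2 * Real.pi)).repr.injective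
    ext n
    rw [fourierBasis_repr, map_zero, fourierCoeff_congr_ae hf.coeFn_toLp,
      fourierCoeff_eq_intervalIntegral _ n 0, zero_add]
    have h1 := hp _ (isTestFunction_fourier (-n))
    rw [h0] at h1
    simp only [smul_eq_mul]
    simp_rw [mul_comm (fourier (-n) _ : ℂ)]
    rw [← h1]
    simp
  have h2 : (f : S1 → ℂ) =ᵐ[AddCircle.haarAddCircle] 0 := by
    have h3 := hf.coeFn_toLp
    rw [hz] at h3
    exact h3.symm.trans (Lp.coeFn_zero _ _ _)
  rw [Lp.eq_zero_iff_ae_eq_zero]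
  exact Measure.ae_smul_measure h2 (ENNReal.ofReal (2 * Real.pi))

/-- The operator `-Δ` on `L²(S¹)`, with domain `H²(S¹)`. -/
def negLaplacian : L2 (volume : Measure S1) →ₗ.[ℂ] L2 (volume : Measure S1) :=
  negLaplacianGraph.toLinearPMap

/-! ### The generalized wave operator `A + ∂_tt` on `L²(M × S¹)` -/

section Wave

variable {M : Type*} [MeasurableSpace M] {μ : Measure M} [IsFiniteMeasure μ]

lemma memLp_tensor (ζ : L2 μ) (l : ℤ) :
    MemLp (fun p : M × S1 => ζ p.1 * (fourier l p.2 : ℂ)) 2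
      (μ.prod (volume : Measure S1)) := by
  have h1 : MemLp (fun p : M × S1 => ζ p.1) 2 (μ.prod (volume : Measure S1)) :=
    (Lp.memLp ζ).comp_fst _
  have h2 : MemLp (fun p : M × S1 => (fourier l p.2 : ℂ)) ∞ (μ.prod (volume : Measure S1)) := by
    refine memLp_top_of_bound ?_ 1 (Filter.Eventually.of_forall fun p => ?_)
    · exact (((fourier l).continuous.measurable).comp measurable_snd).aestronglyMeasurable
    · rw [fourier_apply, Circle.norm_coe]
  exact h2.mul h1

/-- The function `(x, t) ↦ ζ(x) e^{ilt}` in `L²(M × S¹)`. -/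
def tensor (ζ : L2 μ) (l : ℤ) : L2 (μ.prod (volume : Measure S1)) :=
  (memLp_tensor ζ l).toLp _

/-- `ζ` lies in the domain of `A` and `A ζ = ν ζ`. -/
def IsEigenpair (A : L2 μ →ₗ.[ℂ] L2 μ) (ν : ℝ) (ζ : L2 μ) : Prop :=
  ∃ z : A.domain, (z : L2 μ) = ζ ∧ A z = (ν : ℂ) • ζ

/-- Closed linear span of the functions `ζ(x) e^{ilt}` with `ζ` an eigenfunction of `A` and
`l ∈ ℤ`. It is all of `L²(M × S¹)` if `L²(M)` has an orthonormal basis of eigenfunctions of `A`. -/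
def eigenSpan (A : L2 μ →ₗ.[ℂ] L2 μ) : Submodule ℂ (L2 (μ.prod (volume : Measure S1))) :=
  (Submodule.span ℂ {w | ∃ (ν : ℝ) (ζ : L2 μ) (l : ℤ), IsEigenpair A ν ζ ∧ w = tensor ζ l}
    ).topologicalClosure

/-- The graph of `A + ∂_tt`: if `ζ_k` is an orthonormal basis of `L²(M)` with `A ζ_k = ν_k ζ_k`,
then `v = ∑ a_{kl} ζ_k ⊗ e_l` lies in the domain iff `∑ (ν_k - l²)² |a_{kl}|² < ∞`, and it is
mapped to `f = ∑ (ν_k - l²) a_{kl} ζ_k ⊗ e_l`. This is expressed, without choosing a basis, by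
comparing the coefficients of `f` and `v` with respect to all the functions `ζ ⊗ e_l`. -/
def waveGraph (A : L2 μ →ₗ.[ℂ] L2 μ) :
    Submodule ℂ (L2 (μ.prod (volume : Measure S1)) × L2 (μ.prod (volume : Measure S1))) where
  carrier := {p | p.1 ∈ eigenSpan A ∧ p.2 ∈ eigenSpan A ∧
    ∀ (ν : ℝ) (ζ : L2 μ) (l : ℤ), IsEigenpair A ν ζ →
      inner ℂ (tensor ζ l) p.2 = ((ν : ℂ) - (l : ℂ) ^ 2) * inner ℂ (tensor ζ l) p.1}
  zero_mem' := ⟨zero_mem _, zero_mem _, fun ν ζ l _ => by simp⟩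
  add_mem' := by
    rintro p q ⟨hp1, hp2, hp⟩ ⟨hq1, hq2, hq⟩
    refine ⟨add_mem hp1 hq1, add_mem hp2 hq2, fun ν ζ l h => ?_⟩
    rw [Prod.fst_add, Prod.snd_add, inner_add_right, inner_add_right, hp ν ζ l h, hq ν ζ l h,
      mul_add]
  smul_mem' := by
    rintro c p ⟨hp1, hp2, hp⟩
    refine ⟨Submodule.smul_mem _ c hp1, Submodule.smul_mem _ c hp2, fun ν ζ l h => ?_⟩
    rw [Prod.smul_fst, Prod.smul_snd, inner_smul_right, inner_smul_right, hp ν ζ l h]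
    ring

lemma waveGraph_single_valued (A : L2 μ →ₗ.[ℂ] L2 μ) :
    ∀ p ∈ waveGraph A, p.1 = 0 → p.2 = 0 := by
  rintro ⟨v, f⟩ ⟨-, hf, h⟩ hv
  simp only at hv hf h ⊢
  subst hv
  have hle : eigenSpan A ≤ (Submodule.span ℂ {f})ᗮ := by
    refine Submodule.topologicalClosure_minimal _ ?_ (Submodule.isClosed_orthogonal _)
    rw [Submodule.span_le]
    rintro w ⟨ν, ζ, l, hz, rfl⟩
    rw [SetLike.mem_coe, Submodule.mem_orthogonal_singleton_iff_inner_left, h ν ζ l hz,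
      inner_zero_right, mul_zero]
  have := (Submodule.mem_orthogonal_singleton_iff_inner_left).1 (hle hf)
  exact inner_self_eq_zero.1 this

/-- The generalized wave operator `L_A = A + ∂_tt` on `L²(M × S¹)`. -/
def waveOperator (A : L2 μ →ₗ.[ℂ] L2 μ) :
    L2 (μ.prod (volume : Measure S1)) →ₗ.[ℂ] L2 (μ.prod (volume : Measure S1)) :=
  (waveGraph A).toLinearPMap

/-- A set `Ω` has the control property for an operator `L` on `L²(X)`:
`‖u‖_{L²(X)} ≤ C ‖u‖_{L²(Ω)}` for all `u ∈ ker L`, with some constant `C > 0`. -/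
def HasControlProperty {X : Type*} [MeasurableSpace X] {ρ : Measure X}
    (L : L2 ρ →ₗ.[ℂ] L2 ρ) (Ω : Set X) : Prop :=
  ∃ C : ℝ, 0 < C ∧ ∀ u : L.domain, L u = 0 →
    eLpNorm (u : L2 ρ) 2 ρ ≤ ENNReal.ofReal C * eLpNorm (u : L2 ρ) 2 (ρ.restrict Ω)

end Wave

end GenWave

end

/-! A kernel element has Fourier modes `e^{ikx} e^{ilt}` with `l ^ 2 = (k ^ 2) ^ m` only, so it
reads `∑ c_l(x) e^{ilt}`, where `l` runs through the integers `± k ^ m` and each `c_l` involves at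
most two frequencies `n` and `-n`. Since `m ≥ 2`, the gaps between successive values of `l` tend to
infinity.

The core is an estimate of Ingham type: such a gap condition bounds `∑ ‖a l‖²` by the integral of
`‖∑ a l e^{ilt}‖²` over an arbitrarily short interval. Large gaps are treated by near orthogonality
(`exists_gap_intervalControl`). The finitely many remaining frequencies are restored one by one
(`IntervalControl.exists_insert`): a twisted difference removes the new frequency and leaves the
others with factors bounded below on average. The same tools control the pairs `{n, -n}` uniformly
in `n`.

On a small square inside `Ω`, the gap estimate in `t` at fixed `x` and the pair estimate in `x` for
each `c_l` combine to control finite sums (`exists_sum_enorm_le_lintegral_biTrigPoly`). Both sides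
are continuous in `L²`, so the bound extends to the closed span of the resonant modes, which
contains the kernel. -/

noncomputable section

namespace GenWave

/-! ### Trigonometric polynomials on intervals -/

/-- The exponential `t ↦ e^{int}` on the line. -/
def expI (n : ℤ) (t : ℝ) : ℂ := Complex.exp ((n : ℂ) * Complex.I * t)

lemma continuous_expI (n : ℤ) : Continuous (expI n) := by
  unfold expI; fun_prop

lemma expI_add_right (n : ℤ) (s t : ℝ) : expI n (s + t) = expI n s * expI n t := by
  simp only [expI, ← Complex.exp_add]; congr 1; push_cast; ring

lemma expI_add_left (n m : ℤ) (t : ℝ) : expI (n + m) t = expI n t * expI m t := by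
  simp only [expI, ← Complex.exp_add]; congr 1; push_cast; ring

@[simp] lemma expI_zero_left (t : ℝ) : expI 0 t = 1 := by simp [expI]

@[simp] lemma expI_zero_right (n : ℤ) : expI n 0 = 1 := by simp [expI]

lemma expI_eq_cos_add_sin (n : ℤ) (t : ℝ) :
    expI n t = Complex.cos (n * t : ℝ) + Complex.sin (n * t : ℝ) * Complex.I := by
  rw [expI, ← Complex.exp_mul_I]; congr 1; push_cast; ring

@[simp] lemma norm_expI (n : ℤ) (t : ℝ) : ‖expI n t‖ = 1 := by
  have : (n : ℂ) * Complex.I * t = ((n * t : ℝ) : ℂ) * Complex.I := by push_cast; ring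
  rw [expI, this, Complex.norm_exp_ofReal_mul_I]

lemma conj_expI (n : ℤ) (t : ℝ) : (starRingEnd ℂ) (expI n t) = expI (-n) t := by
  rw [expI, expI, ← Complex.exp_conj]; congr 1; simp

lemma integral_expI {n : ℤ} (hn : n ≠ 0) (a b : ℝ) :
    ∫ t in a..b, expI n t = (expI n b - expI n a) / (n * Complex.I) := by
  have h : (n : ℂ) * Complex.I ≠ 0 := mul_ne_zero (by exact_mod_cast hn) Complex.I_ne_zero
  simp only [expI]
  exact integral_exp_mul_complex h

lemma norm_integral_expI_le {n : ℤ} (hn : n ≠ 0) (a b : ℝ) :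
    ‖∫ t in a..b, expI n t‖ ≤ 2 / |(n : ℝ)| := by
  rw [integral_expI hn, norm_div, norm_mul, Complex.norm_I, mul_one, Complex.norm_intCast]
  gcongr
  calc ‖expI n b - expI n a‖ ≤ ‖expI n b‖ + ‖expI n a‖ := norm_sub_le _ _
    _ = 2 := by norm_num

/-- The trigonometric polynomial `∑ a n e^{int}` with frequencies in `S`. -/
def trigPoly (S : Finset ℤ) (a : ℤ → ℂ) (t : ℝ) : ℂ := ∑ n ∈ S, a n * expI n t

lemma continuous_trigPoly (S : Finset ℤ) (a : ℤ → ℂ) : Continuous (trigPoly S a) := by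
  unfold trigPoly
  exact continuous_finsetSum _ fun n _ => continuous_const.mul (continuous_expI n)

lemma continuous_norm_sq_trigPoly (S : Finset ℤ) (a : ℤ → ℂ) :
    Continuous fun t => ‖trigPoly S a t‖ ^ 2 :=
  (continuous_trigPoly S a).norm.pow 2

lemma norm_sq_trigPoly (S : Finset ℤ) (a : ℤ → ℂ) (t : ℝ) :
    ((‖trigPoly S a t‖ ^ 2 : ℝ) : ℂ)
      = ∑ n ∈ S, ∑ m ∈ S, a n * (starRingEnd ℂ) (a m) * expI (n - m) t := by
  rw [Complex.ofReal_pow, ← Complex.mul_conj', trigPoly, map_sum, Finset.sum_mul_sum]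
  refine Finset.sum_congr rfl fun n _ => Finset.sum_congr rfl fun m _ => ?_
  rw [map_mul, conj_expI, sub_eq_add_neg, expI_add_left]
  ring

lemma integral_norm_sq_trigPoly (S : Finset ℤ) (a : ℤ → ℂ) (p q c : ℝ) :
    ((∫ t in p..q, ‖trigPoly S a (c + t)‖ ^ 2 : ℝ) : ℂ)
      = ∑ n ∈ S, ∑ m ∈ S,
          a n * (starRingEnd ℂ) (a m) * expI (n - m) c * ∫ t in p..q, expI (n - m) t := by
  rw [← intervalIntegral.integral_ofReal]
  simp only [norm_sq_trigPoly, expI_add_right]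
  have hc (n m : ℤ) : Continuous fun t : ℝ =>
      a n * (starRingEnd ℂ) (a m) * (expI (n - m) c * expI (n - m) t) :=
    continuous_const.mul (continuous_const.mul (continuous_expI _))
  rw [intervalIntegral.integral_finsetSum fun n _ =>
    (continuous_finsetSum _ fun m _ => hc n m).intervalIntegrable _ _]
  refine Finset.sum_congr rfl fun n _ => ?_
  rw [intervalIntegral.integral_finsetSum fun m _ => (hc n m).intervalIntegrable _ _]
  refine Finset.sum_congr rfl fun m _ => ?_
  simp only [← mul_assoc]
  rw [intervalIntegral.integral_const_mul]

/-- Averaging over two variables squares the factor `∫ e^{ikt}`. Its decay thus improves from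
`1/|k|` to `1/k²`, which is summable over the integers. -/
lemma integral_integral_norm_sq_trigPoly (S : Finset ℤ) (a : ℤ → ℂ) (p δ : ℝ) :
    ((∫ s in (0 : ℝ)..δ, ∫ t in (0 : ℝ)..δ, ‖trigPoly S a (p + s + t)‖ ^ 2 : ℝ) : ℂ)
      = ∑ n ∈ S, ∑ m ∈ S,
          a n * (starRingEnd ℂ) (a m) * expI (n - m) p
            * (∫ t in (0 : ℝ)..δ, expI (n - m) t) ^ 2 := by
  rw [← intervalIntegral.integral_ofReal]
  simp only [integral_norm_sq_trigPoly, expI_add_right]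
  set G : ℤ → ℂ := fun k => ∫ t in (0 : ℝ)..δ, expI k t
  have hc (n m : ℤ) : Continuous fun s : ℝ =>
      a n * (starRingEnd ℂ) (a m) * (expI (n - m) p * expI (n - m) s) * G (n - m) :=
    (continuous_const.mul (continuous_const.mul (continuous_expI _))).mul continuous_const
  rw [intervalIntegral.integral_finsetSum fun n _ =>
    (continuous_finsetSum _ fun m _ => hc n m).intervalIntegrable _ _]
  refine Finset.sum_congr rfl fun n _ => ?_
  rw [intervalIntegral.integral_finsetSum fun m _ => (hc n m).intervalIntegrable _ _]
  refine Finset.sum_congr rfl fun m _ => ?_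
  rw [intervalIntegral.integral_mul_const]
  simp only [← mul_assoc]
  rw [intervalIntegral.integral_const_mul]
  ring

/-- Parseval's identity for trigonometric polynomials. -/
lemma integral_two_pi_norm_sq_trigPoly (S : Finset ℤ) (a : ℤ → ℂ) (p : ℝ) :
    ∫ t in p..p + 2 * Real.pi, ‖trigPoly S a t‖ ^ 2 = 2 * Real.pi * ∑ n ∈ S, ‖a n‖ ^ 2 := by
  have h := integral_norm_sq_trigPoly S a p (p + 2 * Real.pi) 0
  simp only [zero_add] at h
  apply Complex.ofReal_injective
  rw [h, Finset.mul_sum, Complex.ofReal_sum]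
  refine Finset.sum_congr rfl fun n hn => ?_
  rw [Finset.sum_eq_single_of_mem n hn]
  · simp only [sub_self, expI_zero_left, intervalIntegral.integral_const, Complex.real_smul]
    rw [mul_one, mul_one, Complex.mul_conj']
    push_cast
    ring
  · intro m _ hm
    have hk : n - m ≠ 0 := sub_ne_zero.2 hm.symm
    have h2 : expI (n - m) (2 * Real.pi) = 1 := by
      rw [expI, ← Complex.exp_int_mul_two_pi_mul_I (n - m)]
      congr 1
      push_cast
      ring
    rw [integral_expI hk, expI_add_right, h2]
    simp

lemma intervalIntegral_mono_interval {f : ℝ → ℝ} (hf : Continuous f) (h0 : ∀ t, 0 ≤ f t)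
    {a b c d : ℝ} (hca : c ≤ a) (hab : a ≤ b) (hbd : b ≤ d) :
    ∫ t in a..b, f t ≤ ∫ t in c..d, f t :=
  intervalIntegral.integral_mono_interval hca hab hbd
    (Filter.Eventually.of_forall h0) (hf.intervalIntegrable _ _)

/-- All trigonometric polynomials with frequencies in `E` are controlled, with constant `C`,
on all intervals of length `δ`. -/
def IntervalControl (E : Set ℤ) (δ C : ℝ) : Prop :=
  ∀ (p : ℝ) (S : Finset ℤ) (a : ℤ → ℂ), (S : Set ℤ) ⊆ E →
    ∑ n ∈ S, ‖a n‖ ^ 2 ≤ C * ∫ t in p..p + δ, ‖trigPoly S a t‖ ^ 2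

lemma IntervalControl.mono {E E' : Set ℤ} {δ δ' C C' : ℝ} (h : IntervalControl E δ C)
    (hE : E' ⊆ E) (hδ0 : 0 ≤ δ) (hδ : δ ≤ δ') (hC0 : 0 ≤ C) (hC : C ≤ C') :
    IntervalControl E' δ' C' := by
  intro p S a hS
  refine (h p S a (hS.trans hE)).trans ?_
  have h1 := intervalIntegral_mono_interval (continuous_norm_sq_trigPoly S a)
    (fun t => sq_nonneg _) le_rfl (by linarith) (by linarith : p + δ ≤ p + δ')
  have h2 : 0 ≤ ∫ t in p..p + δ, ‖trigPoly S a t‖ ^ 2 :=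
    intervalIntegral.integral_nonneg (by linarith) fun t _ => sq_nonneg _
  exact mul_le_mul hC h1 h2 (hC0.trans hC)

/-! ### Ingham's inequality for large gaps -/

lemma exists_gap_sum_le {ε : ℝ} (hε : 0 < ε) :
    ∃ R : ℕ, ∀ T : Finset ℤ, (∀ k ∈ T, (R : ℤ) < |k|) → ∑ k ∈ T, 4 / (k : ℝ) ^ 2 < ε := by
  have hs : Summable fun k : ℤ => 4 / (k : ℝ) ^ 2 := by
    have h := (Real.summable_one_div_int_pow (p := 2)).2 (by norm_num)
    simpa [div_eq_mul_inv] using h.mul_left 4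
  obtain ⟨F, hF⟩ := summable_iff_vanishing.1 hs (Metric.ball 0 ε) (Metric.ball_mem_nhds _ hε)
  refine ⟨F.sup Int.natAbs, fun T hT => ?_⟩
  have hd : Disjoint T F := by
    rw [Finset.disjoint_left]
    intro k hk hkF
    have h1 := hT k hk
    have h2 : k.natAbs ≤ F.sup Int.natAbs := Finset.le_sup (f := Int.natAbs) hkF
    rw [Int.abs_eq_natAbs] at h1
    omega
  have h := hF T hd
  rw [mem_ball_zero_iff, Real.norm_eq_abs] at h
  exact (le_abs_self _).trans_lt h

/-- Schur's test for a symmetric nonnegative kernel: bound `b n * b m` by half the sum of squares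
and use the row sums. -/
lemma sum_sum_mul_le (S : Finset ℤ) (b : ℤ → ℝ) (q : ℤ → ℝ) (hq0 : ∀ k, 0 ≤ q k)
    (hqs : ∀ k, q (-k) = q k) {B : ℝ} (hB : ∀ n ∈ S, ∑ m ∈ S, q (n - m) ≤ B) :
    ∑ n ∈ S, ∑ m ∈ S, b n * b m * q (n - m) ≤ B * ∑ n ∈ S, b n ^ 2 := by
  have h1 : ∑ n ∈ S, ∑ m ∈ S, b n * b m * q (n - m)
      ≤ ∑ n ∈ S, ∑ m ∈ S, (b n ^ 2 * q (n - m) / 2 + b m ^ 2 * q (m - n) / 2) := by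
    refine Finset.sum_le_sum fun n _ => Finset.sum_le_sum fun m _ => ?_
    rw [← hqs (m - n), neg_sub]
    nlinarith [mul_nonneg (sq_nonneg (b n - b m)) (hq0 (n - m))]
  have h2 : ∑ n ∈ S, ∑ m ∈ S, b n ^ 2 * q (n - m) / 2 ≤ B / 2 * ∑ n ∈ S, b n ^ 2 := by
    rw [Finset.mul_sum]
    refine Finset.sum_le_sum fun n hn => ?_
    rw [← Finset.sum_div, ← Finset.mul_sum]
    nlinarith [mul_le_mul_of_nonneg_left (hB n hn) (sq_nonneg (b n))]
  refine h1.trans ?_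
  simp only [Finset.sum_add_distrib]
  rw [Finset.sum_comm (f := fun n m => b m ^ 2 * q (m - n) / 2)]
  linarith

/-- Ingham's inequality: widely spaced frequencies are controlled on short intervals. -/
theorem exists_gap_intervalControl {δ : ℝ} (hδ : 0 < δ) :
    ∃ R : ℕ, ∀ E : Set ℤ, (∀ n ∈ E, ∀ m ∈ E, n ≠ m → (R : ℤ) < |n - m|) →
      IntervalControl E (2 * δ) (2 / δ) := by
  obtain ⟨R, hR⟩ := exists_gap_sum_le (ε := δ ^ 2 / 2) (by positivity)
  refine ⟨R, fun E hE p S a hS => ?_⟩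
  set W : ℝ := ∫ s in (0 : ℝ)..δ, ∫ t in (0 : ℝ)..δ, ‖trigPoly S a (p + s + t)‖ ^ 2 with hW
  set J : ℝ := ∫ t in p..p + 2 * δ, ‖trigPoly S a t‖ ^ 2 with hJ
  -- For `s, t ∈ [0, δ]` the point `p + s + t` stays in `[p, p + 2δ]`.
  have hWJ : W ≤ δ * J := by
    have hcont : Continuous fun s : ℝ =>
        ∫ t in (0 : ℝ)..δ, ‖trigPoly S a (p + s + t)‖ ^ 2 := by
      apply intervalIntegral.continuous_parametric_intervalIntegral_of_continuous'
      exact (continuous_norm_sq_trigPoly S a).comp (by fun_prop)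
    have h1 : W ≤ ∫ s in (0 : ℝ)..δ, J := by
      refine intervalIntegral.integral_mono_on hδ.le (hcont.intervalIntegrable _ _)
        (by simp) fun s hs => ?_
      rw [intervalIntegral.integral_comp_add_left (fun t => ‖trigPoly S a t‖ ^ 2) (p + s)]
      exact intervalIntegral_mono_interval (continuous_norm_sq_trigPoly S a)
        (fun t => sq_nonneg _) (by linarith [hs.1]) (by linarith) (by linarith [hs.2])
    simpa using h1
  -- The diagonal of `W` is exactly `δ²` times the sum of squares. The off-diagonal part has row
  -- sums at most `δ² / 2`, so half of the diagonal survives.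
  have hmain : δ ^ 2 * ∑ n ∈ S, ‖a n‖ ^ 2 - W ≤ δ ^ 2 / 2 * ∑ n ∈ S, ‖a n‖ ^ 2 := by
    have hB : ∀ n ∈ S, ∑ m ∈ S, 4 / (((n - m : ℤ)) : ℝ) ^ 2 ≤ δ ^ 2 / 2 := by
      intro n hn
      have h1 := hR ((S.erase n).image fun m => n - m) (by
        intro k hk
        obtain ⟨m, hm, rfl⟩ := Finset.mem_image.1 hk
        exact hE n (hS hn) m (hS (Finset.mem_of_mem_erase hm)) (Finset.ne_of_mem_erase hm).symm)
      rw [Finset.sum_image (by intro x _ y _ h; simpa using h)] at h1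
      -- The term `m = n` contributes `4 / 0 = 0`.
      rw [← Finset.add_sum_erase S _ hn]
      simpa using h1.le
    refine le_trans ?_ (sum_sum_mul_le S (fun n => ‖a n‖) (fun k => 4 / (k : ℝ) ^ 2)
      (fun k => by positivity) (fun k => by simp) hB)
    have hdiag : ((δ ^ 2 * ∑ n ∈ S, ‖a n‖ ^ 2 : ℝ) : ℂ)
        = ∑ n ∈ S, ∑ m ∈ S, if n = m then (δ : ℂ) ^ 2 * (‖a n‖ : ℂ) ^ 2 else 0 := by
      rw [Finset.mul_sum, Complex.ofReal_sum]
      refine Finset.sum_congr rfl fun n hn => ?_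
      simp [hn]
    calc δ ^ 2 * ∑ n ∈ S, ‖a n‖ ^ 2 - W
        ≤ ‖((δ ^ 2 * ∑ n ∈ S, ‖a n‖ ^ 2 - W : ℝ) : ℂ)‖ := by
          rw [Complex.norm_real]; exact le_abs_self _
      _ ≤ _ := by
          rw [Complex.ofReal_sub, hdiag, hW, integral_integral_norm_sq_trigPoly,
            ← Finset.sum_sub_distrib]
          refine (norm_sum_le _ _).trans (Finset.sum_le_sum fun n _ => ?_)
          rw [← Finset.sum_sub_distrib]
          refine (norm_sum_le _ _).trans (Finset.sum_le_sum fun m _ => ?_)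
          split_ifs with hnm
          · subst hnm
            have : (δ : ℂ) ^ 2 * (‖a n‖ : ℂ) ^ 2 - a n * (starRingEnd ℂ) (a n)
                * expI (n - n) p * (∫ t in (0 : ℝ)..δ, expI (n - n) t) ^ 2 = 0 := by
              rw [Complex.mul_conj']
              simp [mul_comm]
            rw [this]
            simp
          · have hk : n - m ≠ 0 := sub_ne_zero.2 hnm
            rw [zero_sub, norm_neg, norm_mul, norm_mul, norm_mul, norm_expI, mul_one,
              RCLike.norm_conj, norm_pow]
            gcongr
            have h := norm_integral_expI_le hk 0 δ
            calc ‖∫ t in (0 : ℝ)..δ, expI (n - m) t‖ ^ 2 ≤ (2 / |((n - m : ℤ) : ℝ)|) ^ 2 := by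
                  gcongr
              _ = _ := by rw [div_pow, sq_abs]; norm_num
  rw [div_mul_eq_mul_div, le_div_iff₀ hδ]
  have h3 : δ * (δ * ∑ n ∈ S, ‖a n‖ ^ 2) ≤ δ * (2 * J) := by nlinarith
  have := le_of_mul_le_mul_left h3 hδ
  linarith

/-! ### Adding finitely many frequencies -/

lemma norm_sq_expI_sub_one (k : ℤ) (h : ℝ) : ‖expI k h - 1‖ ^ 2 = 2 - 2 * Real.cos (k * h) := by
  have h1 : expI k h - 1
      = ((Real.cos (k * h) - 1 : ℝ) : ℂ) + (Real.sin (k * h) : ℝ) * Complex.I := by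
    rw [expI_eq_cos_add_sin]
    push_cast
    ring
  rw [h1, ← Complex.normSq_eq_norm_sq, Complex.normSq_add_mul_I]
  nlinarith [Real.sin_sq_add_cos_sq (k * h)]

lemma continuous_norm_sq_expI_sub_one (k : ℤ) : Continuous fun h => ‖expI k h - 1‖ ^ 2 :=
  ((continuous_expI k).sub continuous_const).norm.pow 2

lemma integral_norm_sq_expI_sub_one_pos {η : ℝ} (hη : 0 < η) {k : ℤ} (hk : k ≠ 0) :
    0 < ∫ h in (0 : ℝ)..η, ‖expI k h - 1‖ ^ 2 := by
  refine intervalIntegral.integral_pos hη (continuous_norm_sq_expI_sub_one k).continuousOn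
    (fun x _ => sq_nonneg _) ?_
  have hk' : 0 < |(k : ℝ)| := abs_pos.2 (by exact_mod_cast hk)
  -- The point is chosen so that `0 < |k c| ≤ 1 < 2π`, whence `cos (k c) ≠ 1`.
  set c := min η (1 / |(k : ℝ)|) with hc
  have hc0 : 0 < c := lt_min hη (by positivity)
  refine ⟨c, ⟨hc0.le, min_le_left _ _⟩, ?_⟩
  rw [norm_sq_expI_sub_one]
  have h1 : |(k : ℝ) * c| ≤ 1 := by
    rw [abs_mul, abs_of_pos hc0]
    calc |(k : ℝ)| * c ≤ |(k : ℝ)| * (1 / |(k : ℝ)|) := by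
          gcongr
          exact min_le_right _ _
      _ = 1 := by field_simp
  have h2 : (k : ℝ) * c ≠ 0 := mul_ne_zero (by exact_mod_cast hk) hc0.ne'
  have h3 : Real.cos (k * c) ≠ 1 := by
    rw [Ne, Real.cos_eq_one_iff_of_lt_of_lt]
    · exact h2
    · linarith [(abs_le.1 h1).1, Real.pi_gt_three]
    · linarith [(abs_le.1 h1).2, Real.pi_gt_three]
  have h4 := lt_of_le_of_ne (Real.cos_le_one (k * c)) h3
  linarith

lemma le_integral_norm_sq_expI_sub_one (η : ℝ) {k : ℤ} (hk : k ≠ 0) :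
    2 * η - 2 / |(k : ℝ)| ≤ ∫ h in (0 : ℝ)..η, ‖expI k h - 1‖ ^ 2 := by
  have hk' : (k : ℝ) ≠ 0 := by exact_mod_cast hk
  simp only [norm_sq_expI_sub_one]
  rw [intervalIntegral.integral_sub (by simp)
    ((by fun_prop : Continuous fun h : ℝ => 2 * Real.cos (k * h)).intervalIntegrable _ _),
    intervalIntegral.integral_const_mul, intervalIntegral.integral_comp_mul_left _ hk',
    integral_cos]
  simp only [intervalIntegral.integral_const, smul_eq_mul, mul_zero, Real.sin_zero, sub_zero]
  have h1 : (k : ℝ)⁻¹ * Real.sin (k * η) ≤ 1 / |(k : ℝ)| := by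
    refine (le_abs_self _).trans ?_
    rw [abs_mul, abs_inv, one_div]
    exact mul_le_of_le_one_right (by positivity) (Real.abs_sin_le_one _)
  have h2 : 2 / |(k : ℝ)| = 2 * (1 / |(k : ℝ)|) := by ring
  rw [h2]
  linarith

/-- For `|k| > 2 / η` the integral is at least `2η - 2 / |k| ≥ η`; only finitely many other `k`
remain, each with a positive integral. -/
lemma exists_le_integral_norm_sq_expI_sub_one {η : ℝ} (hη : 0 < η) :
    ∃ κ : ℝ, 0 < κ ∧ ∀ k : ℤ, k ≠ 0 → κ ≤ ∫ h in (0 : ℝ)..η, ‖expI k h - 1‖ ^ 2 := by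
  obtain ⟨N, hN⟩ := exists_nat_gt (2 / η)
  set F : Finset ℤ := (Finset.Icc (-(N : ℤ) - 1) (N + 1)).erase 0 with hF
  obtain ⟨k₀, hk₀, hmin⟩ := F.exists_min_image
    (fun k : ℤ => ∫ h in (0 : ℝ)..η, ‖expI k h - 1‖ ^ 2) ⟨1, by simp [hF]⟩
  refine ⟨min η (∫ h in (0 : ℝ)..η, ‖expI k₀ h - 1‖ ^ 2), lt_min hη
    (integral_norm_sq_expI_sub_one_pos hη (Finset.ne_of_mem_erase hk₀)), fun k hk => ?_⟩
  by_cases hkF : k ∈ F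
  · exact (min_le_right _ _).trans (hmin k hkF)
  · refine (min_le_left _ _).trans (le_trans ?_ (le_integral_norm_sq_expI_sub_one η hk))
    have h1 : (N : ℤ) ≤ |k| := by
      by_contra hlt
      apply hkF
      rw [hF, Finset.mem_erase, Finset.mem_Icc]
      rw [not_le, abs_lt] at hlt
      exact ⟨hk, by omega, by omega⟩
    have h2 : (N : ℝ) ≤ |(k : ℝ)| := by exact_mod_cast h1
    have h3 : 2 / η < |(k : ℝ)| := hN.trans_le h2
    have h4 : 2 / |(k : ℝ)| < η := by
      rw [div_lt_iff₀ hη] at h3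
      rw [div_lt_iff₀ (lt_of_le_of_lt (by positivity) hN |>.trans_le h2)]
      linarith
    linarith

lemma norm_add_sq_le_two_mul {E : Type*} [SeminormedAddCommGroup E] (x y : E) :
    ‖x + y‖ ^ 2 ≤ 2 * ‖x‖ ^ 2 + 2 * ‖y‖ ^ 2 := by
  have h := norm_add_le x y
  nlinarith [norm_nonneg (x + y), norm_nonneg x, norm_nonneg y, sq_nonneg (‖x‖ - ‖y‖)]

lemma norm_sub_sq_le_two_mul {E : Type*} [SeminormedAddCommGroup E] (x y : E) :
    ‖x - y‖ ^ 2 ≤ 2 * ‖x‖ ^ 2 + 2 * ‖y‖ ^ 2 := by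
  simpa [sub_eq_add_neg] using norm_add_sq_le_two_mul x (-y)

lemma trigPoly_erase {S : Finset ℤ} {n₀ : ℤ} (hn₀ : n₀ ∈ S) (a : ℤ → ℂ) (t : ℝ) :
    trigPoly S a t = a n₀ * expI n₀ t + trigPoly (S.erase n₀) a t :=
  (Finset.add_sum_erase S _ hn₀).symm

/-- Undoing the phase that a shift by `h` gives to the frequency `n₀` makes that term cancel in the
difference. -/
lemma expI_mul_trigPoly_shift_sub {S : Finset ℤ} {n₀ : ℤ} (hn₀ : n₀ ∈ S) (a : ℤ → ℂ)
    (h t : ℝ) :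
    expI (-n₀) h * trigPoly S a (h + t) - trigPoly S a t
      = trigPoly (S.erase n₀) (fun n => a n * (expI (n - n₀) h - 1)) t := by
  have h0 : expI (-n₀) h * expI n₀ h = 1 := by rw [← expI_add_left]; simp
  rw [trigPoly_erase hn₀, trigPoly_erase hn₀, expI_add_right]
  have h1 : expI (-n₀) h * (a n₀ * (expI n₀ h * expI n₀ t)) = a n₀ * expI n₀ t := by
    linear_combination (a n₀ * expI n₀ t) * h0
  rw [mul_add, h1]
  simp only [trigPoly, Finset.mul_sum, add_sub_add_left_eq_sub, ← Finset.sum_sub_distrib]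
  refine Finset.sum_congr rfl fun n _ => ?_
  rw [expI_add_right, sub_eq_add_neg n, expI_add_left]
  ring

/-- The twisted difference has its frequencies in `E`, so `hE` applies to it. Both the interval of
length `δ` and its shift by `h ≤ η` lie in the longer interval; the factor `4` is `2 + 2` from the
square of a difference. -/
lemma IntervalControl.sum_shift_le {E : Set ℤ} {δ η C : ℝ} (hC : 0 ≤ C)
    (hE : IntervalControl E δ C) (hδ : 0 ≤ δ) (p : ℝ) {S : Finset ℤ} {n₀ : ℤ} (hn₀ : n₀ ∈ S)
    (hS : ((S.erase n₀ : Finset ℤ) : Set ℤ) ⊆ E) (a : ℤ → ℂ) {h : ℝ} (hh0 : 0 ≤ h)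
    (hhη : h ≤ η) :
    ∑ n ∈ S.erase n₀, ‖a n‖ ^ 2 * ‖expI (n - n₀) h - 1‖ ^ 2
      ≤ 4 * C * ∫ t in p..p + (δ + η), ‖trigPoly S a t‖ ^ 2 := by
  set f := trigPoly S a
  have hf2 : Continuous fun t => ‖f t‖ ^ 2 := continuous_norm_sq_trigPoly S a
  set J : ℝ := ∫ t in p..p + (δ + η), ‖f t‖ ^ 2
  have h1 := hE p (S.erase n₀) (fun n => a n * (expI (n - n₀) h - 1)) hS
  simp only [norm_mul, mul_pow] at h1
  refine h1.trans ?_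
  rw [mul_comm 4 C, mul_assoc]
  refine mul_le_mul_of_nonneg_left ?_ hC
  have hshift : Continuous fun t => ‖f (h + t)‖ ^ 2 := hf2.comp (by fun_prop)
  have h2 : ∫ t in p..p + δ,
      ‖trigPoly (S.erase n₀) (fun n => a n * (expI (n - n₀) h - 1)) t‖ ^ 2
      ≤ ∫ t in p..p + δ, (2 * ‖f (h + t)‖ ^ 2 + 2 * ‖f t‖ ^ 2) := by
    refine intervalIntegral.integral_mono_on (by linarith)
      ((continuous_norm_sq_trigPoly _ _).intervalIntegrable _ _)
      (((hshift.const_mul 2).add (hf2.const_mul 2)).intervalIntegrable _ _) fun t _ => ?_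
    rw [← expI_mul_trigPoly_shift_sub hn₀]
    refine (norm_sub_sq_le_two_mul _ _).trans ?_
    rw [norm_mul, norm_expI, one_mul]
  rw [intervalIntegral.integral_add ((hshift.const_mul 2).intervalIntegrable _ _)
    ((hf2.const_mul 2).intervalIntegrable _ _), intervalIntegral.integral_const_mul,
    intervalIntegral.integral_const_mul,
    intervalIntegral.integral_comp_add_left (fun t => ‖f t‖ ^ 2) h] at h2
  have h3 : ∫ t in h + p..h + (p + δ), ‖f t‖ ^ 2 ≤ J :=
    intervalIntegral_mono_interval hf2 (fun t => sq_nonneg _) (by linarith) (by linarith)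
      (by linarith)
  have h4 : ∫ t in p..p + δ, ‖f t‖ ^ 2 ≤ J :=
    intervalIntegral_mono_interval hf2 (fun t => sq_nonneg _) le_rfl (by linarith)
      (by linarith)
  linarith

/-- One frequency can be added at the cost of a slightly longer interval. -/
theorem IntervalControl.exists_insert {E : Set ℤ} {δ η C : ℝ} (hC : 0 ≤ C)
    (hE : IntervalControl E δ C) (hδ : 0 < δ) (hη : 0 < η) (hδη : δ ≤ 2 * Real.pi) (n₀ : ℤ) :
    ∃ C' : ℝ, 0 ≤ C' ∧ IntervalControl (insert n₀ E) (δ + η) C' := by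
  obtain ⟨κ, hκ, hκle⟩ := exists_le_integral_norm_sq_expI_sub_one hη
  -- `D` bounds the old coefficients after averaging over `h ∈ [0, η]`. `D'` bounds the new one, by
  -- subtracting the old part from the polynomial on an interval of length `δ`.
  set D : ℝ := 4 * C * η / κ with hD
  have hD0 : 0 ≤ D := by positivity
  set D' : ℝ := (2 + 2 * (2 * Real.pi * D)) / δ with hD'
  have hD'0 : 0 ≤ D' := by positivity
  refine ⟨max C (D' + D), le_max_of_le_left hC, fun p S a hS => ?_⟩
  set J : ℝ := ∫ t in p..p + (δ + η), ‖trigPoly S a t‖ ^ 2 with hJ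
  have hJ0 : 0 ≤ J := intervalIntegral.integral_nonneg (by linarith) fun t _ => sq_nonneg _
  by_cases hn₀ : n₀ ∈ S
  swap
  · refine (hE.mono subset_rfl hδ.le (by linarith : δ ≤ δ + η) hC (le_max_left C _)) p S a ?_
    intro n hn
    refine (hS hn).resolve_left ?_
    rintro rfl
    exact hn₀ hn
  have hSE : ((S.erase n₀ : Finset ℤ) : Set ℤ) ⊆ E := fun n hn =>
    (hS (Finset.mem_of_mem_erase hn)).resolve_left (Finset.ne_of_mem_erase hn)
  have h1 : ∑ n ∈ S.erase n₀, ‖a n‖ ^ 2 ≤ D * J := by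
    have hi : ∫ h in (0 : ℝ)..η, ∑ n ∈ S.erase n₀, ‖a n‖ ^ 2 * ‖expI (n - n₀) h - 1‖ ^ 2
        ≤ ∫ h in (0 : ℝ)..η, 4 * C * J :=
      intervalIntegral.integral_mono_on hη.le
        ((continuous_finsetSum _ fun n _ => continuous_const.mul
          (continuous_norm_sq_expI_sub_one _)).intervalIntegrable _ _) (by simp)
        fun h hh => hE.sum_shift_le hC hδ.le p hn₀ hSE a hh.1 hh.2
    rw [intervalIntegral.integral_finsetSum fun n _ =>
      ((continuous_norm_sq_expI_sub_one (n - n₀)).const_mul (‖a n‖ ^ 2)).intervalIntegrable _ _]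
      at hi
    simp only [intervalIntegral.integral_const_mul, intervalIntegral.integral_const,
      sub_zero, smul_eq_mul] at hi
    have hlow : κ * ∑ n ∈ S.erase n₀, ‖a n‖ ^ 2
        ≤ ∑ n ∈ S.erase n₀, ‖a n‖ ^ 2 * ∫ h in (0 : ℝ)..η, ‖expI (n - n₀) h - 1‖ ^ 2 := by
      rw [Finset.mul_sum]
      refine Finset.sum_le_sum fun n hn => ?_
      rw [mul_comm]
      exact mul_le_mul_of_nonneg_left (hκle _ (sub_ne_zero.2 (Finset.ne_of_mem_erase hn)))
        (sq_nonneg _)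
    rw [hD, div_mul_eq_mul_div, le_div_iff₀ hκ]
    linarith
  have h2 : ‖a n₀‖ ^ 2 ≤ D' * J := by
    -- As `δ ≤ 2π`, Parseval over a full period bounds the old part from above.
    have hv : ∫ t in p..p + δ, ‖trigPoly (S.erase n₀) a t‖ ^ 2 ≤ 2 * Real.pi * (D * J) := by
      refine (intervalIntegral_mono_interval (continuous_norm_sq_trigPoly _ _)
        (fun t => sq_nonneg _) le_rfl (by linarith)
        (by linarith : p + δ ≤ p + 2 * Real.pi)).trans ?_
      rw [integral_two_pi_norm_sq_trigPoly]
      exact mul_le_mul_of_nonneg_left h1 Real.two_pi_pos.le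
    have hu : ∫ t in p..p + δ, ‖trigPoly S a t‖ ^ 2 ≤ J :=
      intervalIntegral_mono_interval (continuous_norm_sq_trigPoly S a) (fun t => sq_nonneg _)
        le_rfl (by linarith) (by linarith)
    have hi : ∫ t in p..p + δ, ‖a n₀‖ ^ 2
        ≤ ∫ t in p..p + δ, (2 * ‖trigPoly S a t‖ ^ 2 + 2 * ‖trigPoly (S.erase n₀) a t‖ ^ 2) := by
      refine intervalIntegral.integral_mono_on (by linarith) (by simp)
        ((((continuous_norm_sq_trigPoly S a).const_mul 2).add
          ((continuous_norm_sq_trigPoly _ a).const_mul 2)).intervalIntegrable _ _) fun t _ => ?_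
      refine le_trans (le_of_eq ?_) (norm_sub_sq_le_two_mul _ _)
      rw [trigPoly_erase hn₀, add_sub_cancel_right, norm_mul, norm_expI, mul_one]
    rw [intervalIntegral.integral_add
      (((continuous_norm_sq_trigPoly S a).const_mul 2).intervalIntegrable _ _)
      (((continuous_norm_sq_trigPoly _ a).const_mul 2).intervalIntegrable _ _),
      intervalIntegral.integral_const_mul, intervalIntegral.integral_const_mul,
      intervalIntegral.integral_const, smul_eq_mul, add_sub_cancel_left] at hi
    rw [hD', div_mul_eq_mul_div, le_div_iff₀ hδ]
    linarith
  rw [← Finset.add_sum_erase S _ hn₀]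
  calc ‖a n₀‖ ^ 2 + ∑ n ∈ S.erase n₀, ‖a n‖ ^ 2 ≤ (D' + D) * J := by linarith
    _ ≤ _ := mul_le_mul_of_nonneg_right (le_max_right _ _) hJ0

/-- The extra length `η` is arbitrary, so each insertion may spend half of what is left; hence the
induction generalizes over `η`. -/
theorem IntervalControl.exists_union_finset {E : Set ℤ} {δ C : ℝ} (hC : 0 ≤ C)
    (hE : IntervalControl E δ C) (hδ : 0 < δ) (F : Finset ℤ) {η : ℝ} (hη : 0 < η)
    (hδη : δ + η ≤ 2 * Real.pi) :
    ∃ C' : ℝ, 0 ≤ C' ∧ IntervalControl (↑F ∪ E) (δ + η) C' := by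
  induction F using Finset.induction_on generalizing η with
  | empty =>
    refine ⟨C, hC, hE.mono ?_ hδ.le (by linarith) hC le_rfl⟩
    simp
  | insert n₀ F _ ih =>
    obtain ⟨C₁, hC₁, h₁⟩ := ih (half_pos hη) (by linarith)
    obtain ⟨C₂, hC₂, h₂⟩ := h₁.exists_insert hC₁ (by linarith) (half_pos hη) (by linarith) n₀
    refine ⟨C₂, hC₂, ?_⟩
    rw [Finset.coe_insert, Set.insert_union]
    rwa [add_assoc, add_halves] at h₂

/-- If the gaps of `E` tend to infinity, then `E` is controlled on every interval. -/
theorem exists_intervalControl_of_gaps {E : Set ℤ}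
    (hE : ∀ R : ℕ, ∃ F : Finset ℤ, ∀ n ∈ E \ F, ∀ m ∈ E \ F, n ≠ m → (R : ℤ) < |n - m|)
    {δ : ℝ} (hδ : 0 < δ) (hδπ : δ ≤ 2 * Real.pi) :
    ∃ C : ℝ, 0 ≤ C ∧ IntervalControl E δ C := by
  -- With `δ / 4`, Ingham's inequality uses an interval of length `δ / 2` and leaves `δ / 2` for the
  -- exceptional set.
  obtain ⟨R, hR⟩ := exists_gap_intervalControl (δ := δ / 4) (by positivity)
  obtain ⟨F, hF⟩ := hE R
  obtain ⟨C, hC, h⟩ := (hR _ hF).exists_union_finset (by positivity) (by positivity) F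
    (η := δ / 2) (by positivity) (by linarith)
  refine ⟨C, hC, h.mono (by simp) (by linarith) (by linarith) hC le_rfl⟩

/-- The frequencies `n` and `-n` are controlled on every interval, uniformly in `n`. -/
theorem exists_intervalControl_pair {δ : ℝ} (hδ : 0 < δ) (hδπ : δ ≤ 2 * Real.pi) :
    ∃ C : ℝ, 0 ≤ C ∧ ∀ n : ℤ, IntervalControl {n, -n} δ C := by
  obtain ⟨R, hR⟩ := exists_gap_intervalControl (δ := δ / 4) (by positivity)
  -- Pairs with `|n| ≤ R` all lie in one finite set, added here to the empty set of frequencies. For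
  -- `|n| > R` the gap `2|n|` exceeds `R`, so Ingham applies directly. Hence one constant serves all
  -- `n`.
  have hempty := hR ∅ (by simp)
  obtain ⟨C, hC, h⟩ := hempty.exists_union_finset (by positivity) (by positivity)
    (Finset.Icc (-R : ℤ) R) (η := δ / 2) (by positivity) (by linarith)
  have h2 : 2 * (δ / 4) + δ / 2 ≤ δ := by linarith
  refine ⟨max C (2 / (δ / 4)), le_max_of_le_left hC, fun n => ?_⟩
  by_cases hn : |n| ≤ R
  · refine h.mono ?_ (by linarith) h2 hC (le_max_left _ _)
    rw [abs_le] at hn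
    rintro k (rfl | rfl)
    · left; simp; omega
    · left; simp; omega
  · refine (hR {n, -n} ?_).mono subset_rfl (by linarith) (by linarith) (by positivity)
      (le_max_right _ _)
    have h3 : (R : ℤ) < |n - -n| := by
      rw [not_le] at hn
      rw [sub_neg_eq_add, ← two_mul, abs_mul]
      simp only [Nat.abs_ofNat]
      linarith [abs_nonneg n]
    rintro x (rfl | rfl) y (rfl | rfl) hxy
    · exact absurd rfl hxy
    · exact h3
    · rwa [abs_sub_comm]
    · exact absurd rfl hxy

/-- The gaps between the integers `± n ^ m`, `m ≥ 2`, tend to infinity. -/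
theorem gaps_of_sq_eq_pow {m : ℕ} (hm : 2 ≤ m) (R : ℕ) :
    ∃ F : Finset ℤ, ∀ l ∈ {l : ℤ | ∃ k : ℤ, l ^ 2 = (k ^ 2) ^ m} \ (F : Set ℤ),
      ∀ l' ∈ {l : ℤ | ∃ k : ℤ, l ^ 2 = (k ^ 2) ^ m} \ (F : Set ℤ), l ≠ l' →
      (R : ℤ) < |l - l'| := by
  have habs {l k : ℤ} (h : l ^ 2 = (k ^ 2) ^ m) : l.natAbs = k.natAbs ^ m := by
    have h1 : l.natAbs ^ 2 = (k.natAbs ^ m) ^ 2 := by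
      zify
      rw [sq_abs, h, ← pow_mul, ← pow_mul, mul_comm m 2, pow_mul, pow_mul, sq_abs]
    exact Nat.pow_left_injective (n := 2) (by norm_num) h1
  -- This is where `m ≥ 2` enters: `a ^ m - b ^ m ≥ a ^ (m - 1) ≥ a`.
  have key {a b : ℕ} (hab : b < a) : a + b ^ m ≤ a ^ m := by
    obtain ⟨c, rfl⟩ : ∃ c, m = c + 1 := ⟨m - 1, by omega⟩
    have h1 : b ^ (c + 1) ≤ a ^ c * b := by
      rw [pow_succ]; gcongr
    have h2 : a ≤ a ^ c := Nat.le_self_pow (by omega) a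
    calc a + b ^ (c + 1) ≤ a ^ c + a ^ c * b := add_le_add h2 h1
      _ = a ^ c * (b + 1) := by ring
      _ ≤ a ^ (c + 1) := by rw [pow_succ]; gcongr; omega
  refine ⟨Finset.Icc (-(R : ℤ) ^ m) (R ^ m), ?_⟩
  rintro l ⟨⟨k, hk⟩, hl⟩ l' ⟨⟨k', hk'⟩, hl'⟩ hne
  have big {l k : ℤ} (hk : l ^ 2 = (k ^ 2) ^ m)
      (hl : l ∉ (Finset.Icc (-(R : ℤ) ^ m) (R ^ m) : Finset ℤ)) : R < k.natAbs := by
    by_contra hlt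
    apply hl
    have h1 : l.natAbs ≤ R ^ m := by
      rw [habs hk]; gcongr; omega
    have h2 : |l| ≤ (R : ℤ) ^ m := by
      rw [Int.abs_eq_natAbs]; exact_mod_cast h1
    rw [Finset.mem_Icc]
    exact abs_le.1 h2
  have hb := big hk hl
  have hb' := big hk' hl'
  have ha := habs hk
  have ha' := habs hk'
  have hself : k.natAbs ≤ k.natAbs ^ m := Nat.le_self_pow (by omega) _
  rw [lt_abs]
  -- If the absolute values agree, then `l' = -l` and the gap is `2|l|`; otherwise `key` gives a gap
  -- at least the larger of `|k|` and `|k'|`.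
  rcases lt_trichotomy k.natAbs k'.natAbs with h | h | h
  · have := key h; omega
  · rw [h] at ha hself; omega
  · have := key h; omega

/-! ### From intervals to squares -/

lemma IntervalControl.sum_enorm_le {E : Set ℤ} {δ C : ℝ} (h : IntervalControl E δ C)
    (hδ : 0 ≤ δ) (hC : 0 ≤ C) (p : ℝ) (S : Finset ℤ) (a : ℤ → ℂ) (hS : (S : Set ℤ) ⊆ E) :
    ∑ n ∈ S, ‖a n‖ₑ ^ 2
      ≤ ENNReal.ofReal C * ∫⁻ t in Set.Ioc p (p + δ), ‖trigPoly S a t‖ₑ ^ 2 := by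
  have hsq (z : ℂ) : ‖z‖ₑ ^ 2 = ENNReal.ofReal (‖z‖ ^ 2) := by
    rw [ENNReal.ofReal_pow (norm_nonneg _), ofReal_norm]
  simp only [hsq]
  rw [← ofReal_integral_eq_lintegral_ofReal
      ((continuous_norm_sq_trigPoly S a).integrableOn_Ioc)
      (Filter.Eventually.of_forall fun t => sq_nonneg _),
    ← ENNReal.ofReal_mul hC, ← ENNReal.ofReal_sum_of_nonneg fun n _ => sq_nonneg _,
    ← intervalIntegral.integral_of_le (by linarith)]
  exact ENNReal.ofReal_le_ofReal (h p S a hS)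

/-- The trigonometric polynomial `∑ a (k, l) e^{ikx} e^{ilt}` in two variables. -/
def biTrigPoly (S : Finset (ℤ × ℤ)) (a : ℤ × ℤ → ℂ) (x t : ℝ) : ℂ :=
  ∑ z ∈ S, a z * expI z.1 x * expI z.2 t

/-- The spectrum of the kernel of `(-Δ)^m + ∂_tt`. -/
def kernelSpectrum (m : ℕ) : Set (ℤ × ℤ) := {z | z.2 ^ 2 = (z.1 ^ 2) ^ m}

/-- Trigonometric polynomials with spectrum in `kernelSpectrum m` are controlled on every
square. -/
theorem exists_sum_enorm_le_lintegral_biTrigPoly {m : ℕ} (hm : 2 ≤ m) {δ : ℝ} (hδ : 0 < δ)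
    (hδπ : δ ≤ 2 * Real.pi) :
    ∃ C : ℝ, 0 ≤ C ∧ ∀ (S : Finset (ℤ × ℤ)) (a : ℤ × ℤ → ℂ) (p q : ℝ),
      (S : Set (ℤ × ℤ)) ⊆ kernelSpectrum m →
      ∑ z ∈ S, ‖a z‖ₑ ^ 2 ≤ ENNReal.ofReal C * ∫⁻ x in Set.Ioc p (p + δ),
        ∫⁻ t in Set.Ioc q (q + δ), ‖biTrigPoly S a x t‖ₑ ^ 2 := by
  obtain ⟨C₁, hC₁, h₁⟩ := exists_intervalControl_of_gaps (gaps_of_sq_eq_pow hm) hδ hδπ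
  obtain ⟨C₂, hC₂, h₂⟩ := exists_intervalControl_pair hδ hδπ
  refine ⟨C₂ * C₁, by positivity, fun S a p q hS => ?_⟩
  set L : Finset ℤ := S.image Prod.snd with hL
  set K : ℤ → Finset ℤ := fun l => (S.filter fun z => z.2 = l).image Prod.fst with hK
  have hmem (z : ℤ × ℤ) : z ∈ S ↔ z.2 ∈ L ∧ z.1 ∈ K z.2 := by
    simp only [hL, hK, Finset.mem_image, Finset.mem_filter]
    constructor
    · exact fun h => ⟨⟨z, h, rfl⟩, ⟨z, ⟨h, rfl⟩, rfl⟩⟩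
    · rintro ⟨-, y, ⟨hy, hy2⟩, hy1⟩
      rwa [← Prod.ext hy1 hy2]
  set c : ℤ → ℝ → ℂ := fun l x => trigPoly (K l) (fun k => a (k, l)) x with hc
  have hbi (x t : ℝ) : biTrigPoly S a x t = trigPoly L (fun l => c l x) t := by
    rw [biTrigPoly, Finset.sum_finset_product_right S L K hmem, trigPoly]
    refine Finset.sum_congr rfl fun l _ => ?_
    simp only [hc, trigPoly, Finset.sum_mul]
  -- Since `m ≠ 0`, the value `l ^ 2 = (k ^ 2) ^ m` determines `k ^ 2`.
  have hpair (l : ℤ) (hl : l ∈ L) : ∃ n : ℤ, (K l : Set ℤ) ⊆ {n, -n} := by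
    obtain ⟨⟨n, l'⟩, hz, rfl⟩ := Finset.mem_image.1 hl
    refine ⟨n, fun k hk => ?_⟩
    obtain ⟨⟨k', l⟩, hy, rfl⟩ := Finset.mem_image.1 hk
    rw [Finset.mem_filter] at hy
    have e1 : l' ^ 2 = (n ^ 2) ^ m := hS hz
    have e2 : l ^ 2 = (k' ^ 2) ^ m := hS hy.1
    have e3 : l = l' := hy.2
    rw [e3, e1] at e2
    have e4 := (pow_left_inj₀ (sq_nonneg n) (sq_nonneg k') (by omega)).1 e2
    rcases sq_eq_sq_iff_eq_or_eq_neg.1 e4.symm with h | h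
    · exact Or.inl h
    · exact Or.inr h
  calc ∑ z ∈ S, ‖a z‖ₑ ^ 2 = ∑ l ∈ L, ∑ k ∈ K l, ‖a (k, l)‖ₑ ^ 2 :=
        Finset.sum_finset_product_right S L K hmem
    _ ≤ ∑ l ∈ L, ENNReal.ofReal C₂ * ∫⁻ x in Set.Ioc p (p + δ), ‖c l x‖ₑ ^ 2 := by
        refine Finset.sum_le_sum fun l hl => ?_
        obtain ⟨n, hn⟩ := hpair l hl
        exact (h₂ n).sum_enorm_le hδ.le hC₂ p (K l) (fun k => a (k, l)) hn
    _ = ENNReal.ofReal C₂ * ∫⁻ x in Set.Ioc p (p + δ), ∑ l ∈ L, ‖c l x‖ₑ ^ 2 := by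
        rw [← Finset.mul_sum, lintegral_finsetSum]
        exact fun l _ => (continuous_trigPoly _ _).enorm.measurable.pow_const 2
    _ ≤ ENNReal.ofReal C₂ * ∫⁻ x in Set.Ioc p (p + δ), ENNReal.ofReal C₁ *
          ∫⁻ t in Set.Ioc q (q + δ), ‖biTrigPoly S a x t‖ₑ ^ 2 := by
        gcongr with x
        simp only [hbi]
        refine h₁.sum_enorm_le hδ.le hC₁ q L (fun l => c l x) ?_
        intro l hl
        obtain ⟨z, hz, rfl⟩ := Finset.mem_image.1 hl
        exact ⟨z.1, hS hz⟩
    _ = _ := by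
        rw [lintegral_const_mul' _ _ ENNReal.ofReal_ne_top, ENNReal.ofReal_mul hC₂, mul_assoc]

/-! ### Eigenfunctions -/

/-- The function `x ↦ e^{ikx}` in `L²(S¹)`. -/
def fourierL2 (k : ℤ) : L2 (volume : Measure S1) :=
  ContinuousMap.toLp 2 (volume : Measure S1) ℂ (fourier k)

lemma coeFn_fourierL2 (k : ℤ) : fourierL2 k =ᵐ[volume] (fourier k : S1 → ℂ) :=
  ContinuousMap.coeFn_toLp _ _

/-- Trigonometric polynomials are uniformly dense in the continuous functions, and these are dense
in `L²`. -/
lemma topologicalClosure_span_range_fourierL2 :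
    (Submodule.span ℂ (Set.range fourierL2)).topologicalClosure = ⊤ := by
  convert!
    (ContinuousMap.toLp_denseRange ℂ (volume : Measure S1) ℂ
      (by norm_num : (2 : ℝ≥0∞) ≠ ⊤)).topologicalClosure_map_submodule
      span_fourier_closure_eq_top
  rw [Submodule.map_span, ← Set.range_comp]
  rfl

lemma fourier_coe_eq_expI (k : ℤ) (x : ℝ) : fourier k (x : S1) = expI k x := by
  rw [fourier_coe_apply, expI]
  congr 1
  have : (Real.pi : ℂ) ≠ 0 := by exact_mod_cast Real.pi_ne_zero
  push_cast
  field_simp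

lemma hasDerivAt_expI (k : ℤ) (x : ℝ) :
    HasDerivAt (expI k) (k * Complex.I * expI k x) x := by
  have h : HasDerivAt (fun x : ℝ => (k : ℂ) * Complex.I * x) (k * Complex.I) x := by
    simpa using (Complex.ofRealCLM.hasDerivAt (x := x)).const_mul ((k : ℂ) * Complex.I)
  exact h.cexp.congr_deriv (mul_comm _ _)

lemma IsTestFunction.deriv {φ : ℝ → ℂ} (h : IsTestFunction φ) : IsTestFunction (deriv φ) := by
  refine ⟨(contDiff_infty_iff_deriv.1 h.1).2, fun x => ?_⟩
  rw [← deriv_comp_add_const]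
  congr 1
  exact funext h.2

lemma integral_expI_mul_deriv (k : ℤ) {φ : ℝ → ℂ} (h : IsTestFunction φ) :
    ∫ x in (0 : ℝ)..2 * Real.pi, expI k x * deriv φ x
      = -(k * Complex.I) * ∫ x in (0 : ℝ)..2 * Real.pi, expI k x * φ x := by
  have hd : Differentiable ℝ φ := (contDiff_infty_iff_deriv.1 h.1).1
  rw [intervalIntegral.integral_mul_deriv_eq_deriv_mul
    (fun x _ => hasDerivAt_expI k x) (fun x _ => (hd x).hasDerivAt)
    ((continuous_const.mul (continuous_expI k)).intervalIntegrable _ _)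
    (h.deriv.continuous.intervalIntegrable _ _)]
  have h1 : expI k (2 * Real.pi) = 1 := by
    rw [← fourier_coe_eq_expI, AddCircle.coe_period, fourier_eval_zero]
  have h2 : φ (2 * Real.pi) = φ 0 := by simpa using h.2 0
  rw [h1, h2, expI_zero_right, sub_self, zero_sub, ← intervalIntegral.integral_const_mul,
    ← intervalIntegral.integral_neg]
  congr 1
  funext x
  ring

lemma intervalIntegral_fourierL2_mul (k : ℤ) (φ : ℝ → ℂ) :
    ∫ x in (0 : ℝ)..2 * Real.pi, fourierL2 k (x : S1) * φ x
      = ∫ x in (0 : ℝ)..2 * Real.pi, expI k x * φ x := by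
  refine intervalIntegral.integral_congr_ae ?_
  filter_upwards [ae_interval (coeFn_fourierL2 k)] with x hx hx'
  rw [hx hx', fourier_coe_eq_expI]

lemma isEigenpair_negLaplacian_fourierL2 (k : ℤ) :
    IsEigenpair negLaplacian ((k : ℝ) ^ 2) (fourierL2 k) := by
  have h : (fourierL2 k, (((k : ℝ) ^ 2 : ℝ) : ℂ) • fourierL2 k) ∈ negLaplacianGraph := by
    intro φ hφ
    rw [integral_smul_mul, intervalIntegral_fourierL2_mul, intervalIntegral_fourierL2_mul]
    simp only [mul_neg, intervalIntegral.integral_neg]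
    rw [integral_expI_mul_deriv k hφ.deriv, integral_expI_mul_deriv k hφ]
    push_cast
    linear_combination -(k : ℂ) ^ 2 *
      (∫ x in (0 : ℝ)..2 * Real.pi, expI k x * φ x) * Complex.I_sq
  rw [← Submodule.toLinearPMap_graph_eq _ negLaplacianGraph_single_valued,
    LinearPMap.mem_graph_iff] at h
  exact h

/-- The natural domain of the composition is no obstacle: `opPow A n` sends `ζ` to a multiple of
itself, which is again in `A.domain`. -/
lemma isEigenpair_opPow {A : L2 (volume : Measure S1) →ₗ.[ℂ] L2 (volume : Measure S1)} {ν : ℝ}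
    {ζ : L2 (volume : Measure S1)} (h : IsEigenpair A ν ζ) (n : ℕ) :
    IsEigenpair (opPow A n) (ν ^ n) ζ := by
  induction n with
  | zero => exact ⟨⟨ζ, Submodule.mem_top⟩, rfl, by simp [opPow]⟩
  | succ n ih =>
    obtain ⟨y, hy, hAy⟩ := h
    obtain ⟨z, hz, hBz⟩ := ih
    have hdom : (opPow A n) z ∈ A.domain := by
      rw [hBz, ← hy]
      exact Submodule.smul_mem _ _ y.2
    have hmem : ζ ∈ (opPow A (n + 1)).domain :=
      Submodule.mem_inf.2 ⟨Submodule.mem_map.2 ⟨z, hdom, hz⟩, hz ▸ z.2⟩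
    refine ⟨⟨ζ, hmem⟩, rfl, ?_⟩
    have h1 : (opPow A (n + 1)) ⟨ζ, hmem⟩ = A ⟨(opPow A n) z, hdom⟩ := by
      change A _ = A _
      congr 1
      apply Subtype.ext
      exact LinearPMap.domRestrict_apply hz.symm
    have h2 : (⟨(opPow A n) z, hdom⟩ : A.domain) = ((ν ^ n : ℝ) : ℂ) • y := by
      apply Subtype.ext
      rw [Submodule.coe_smul, hy]
      exact hBz
    rw [h1, h2, LinearPMap.map_smul, hAy, smul_smul]
    push_cast
    rw [pow_succ]

/-! ### Expansion of the kernel -/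

lemma ae_prod_fst {p : S1 → Prop} (h : ∀ᵐ x ∂(volume : Measure S1), p x) :
    ∀ᵐ z ∂(volume : Measure S1).prod (volume : Measure S1), p z.1 :=
  Measure.quasiMeasurePreserving_fst.ae h

/-- `ζ ↦ ζ ⊗ e_l` as a continuous linear map. -/
def tensorCLM (l : ℤ) :
    L2 (volume : Measure S1) →L[ℂ] L2 ((volume : Measure S1).prod (volume : Measure S1)) :=
  LinearMap.mkContinuous
    { toFun := fun ζ => tensor ζ l
      map_add' := fun ζ ξ => by
        rw [tensor, tensor, tensor, ← MemLp.toLp_add]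
        refine MemLp.toLp_congr _ _ ?_
        have h := ae_prod_fst (Lp.coeFn_add ζ ξ)
        filter_upwards [h] with p hp
        rw [hp]
        simp [add_mul]
      map_smul' := fun c ζ => by
        rw [tensor, tensor, RingHom.id_apply, ← MemLp.toLp_const_smul]
        refine MemLp.toLp_congr _ _ ?_
        have h := ae_prod_fst (Lp.coeFn_smul c ζ)
        filter_upwards [h] with p hp
        rw [hp]
        simp [mul_assoc] }
    (((volume : Measure S1) Set.univ ^ (1 / (2 : ℝ≥0∞).toReal)).toReal) (fun ζ => by
      change ‖tensor ζ l‖ ≤ _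
      rw [tensor, Lp.norm_toLp, Lp.norm_def, ← ENNReal.toReal_mul]
      -- Equality holds: `e_l` has modulus one, and the first projection pushes the product measure
      -- to `volume univ • volume`.
      refine le_of_eq (congrArg _ ?_)
      have h1 : eLpNorm (fun p : S1 × S1 => ζ p.1 * (fourier l p.2 : ℂ)) 2
          ((volume : Measure S1).prod volume)
          = eLpNorm ((ζ : S1 → ℂ) ∘ Prod.fst) 2
            ((volume : Measure S1).prod (volume : Measure S1)) := by
        refine eLpNorm_congr_norm_ae (Filter.Eventually.of_forall fun p => ?_)
        rw [norm_mul, fourier_apply, Circle.norm_coe, mul_one, Function.comp_apply]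
      have h2 : Measure.map Prod.fst ((volume : Measure S1).prod (volume : Measure S1))
          = (volume : Measure S1) Set.univ • (volume : Measure S1) := Measure.map_fst_prod
      have h3 : AEStronglyMeasurable (ζ : S1 → ℂ)
          (Measure.map Prod.fst ((volume : Measure S1).prod (volume : Measure S1))) := by
        rw [h2]
        exact (Lp.aestronglyMeasurable ζ).smul_measure _
      rw [h1, ← eLpNorm_map_measure h3 measurable_fst.aemeasurable, h2,
        eLpNorm_smul_measure_of_ne_top (by norm_num), smul_eq_mul]
      simp)

/-- The function `(x, t) ↦ e^{ikx} e^{ilt}` in `L²(S¹ × S¹)`. -/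
def torusExp (z : ℤ × ℤ) : L2 ((volume : Measure S1).prod (volume : Measure S1)) :=
  tensor (fourierL2 z.1) z.2

lemma coeFn_torusExp (z : ℤ × ℤ) :
    torusExp z =ᵐ[(volume : Measure S1).prod volume]
      fun p => (fourier z.1 p.1 : ℂ) * (fourier z.2 p.2 : ℂ) := by
  refine (MemLp.coeFn_toLp (memLp_tensor (fourierL2 z.1) z.2)).trans ?_
  have h := ae_prod_fst (coeFn_fourierL2 z.1)
  filter_upwards [h] with p hp
  rw [hp]

/-- Translation by half a wavelength changes the sign of the integrand. -/
lemma integral_fourier {n : ℤ} (hn : n ≠ 0) : ∫ x : S1, (fourier n x : ℂ) = 0 :=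
  integral_eq_zero_of_add_right_eq_neg (fourier_add_half_inv_index hn Real.two_pi_pos)

lemma inner_torusExp (z w : ℤ × ℤ) :
    inner ℂ (torusExp z) (torusExp w)
      = (∫ x : S1, (fourier (w.1 - z.1) x : ℂ)) * ∫ t : S1, (fourier (w.2 - z.2) t : ℂ) := by
  rw [L2.inner_def, ← integral_prod_mul]
  refine integral_congr_ae ?_
  filter_upwards [coeFn_torusExp z, coeFn_torusExp w] with p hz hw
  rw [hz, hw, RCLike.inner_apply, map_mul, ← fourier_neg, ← fourier_neg, sub_eq_add_neg,
    sub_eq_add_neg, fourier_add, fourier_add]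
  ring

lemma inner_torusExp_of_ne {z w : ℤ × ℤ} (h : z ≠ w) :
    inner ℂ (torusExp z) (torusExp w) = 0 := by
  rw [inner_torusExp]
  by_cases h1 : w.1 - z.1 = 0
  · have h2 : w.2 - z.2 ≠ 0 := fun h2 =>
      h (Prod.ext (sub_eq_zero.1 h1).symm (sub_eq_zero.1 h2).symm)
    rw [integral_fourier h2, mul_zero]
  · rw [integral_fourier h1, zero_mul]

lemma norm_sq_torusExp (z : ℤ × ℤ) : ‖torusExp z‖ ^ 2 = (2 * Real.pi) ^ 2 := by
  have h : ((‖torusExp z‖ ^ 2 : ℝ) : ℂ) = ((2 * Real.pi) ^ 2 : ℝ) := by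
    have h1 := inner_self_eq_norm_sq_to_K (𝕜 := ℂ) (torusExp z)
    rw [inner_torusExp] at h1
    simp only [sub_self, fourier_zero, integral_const, measureReal_def,
      AddCircle.measure_univ, ENNReal.toReal_ofReal Real.two_pi_pos.le] at h1
    have h2 : (((2 * Real.pi) ^ 2 : ℝ) : ℂ) = ((‖torusExp z‖ : ℝ) : ℂ) ^ 2 := by
      refine Eq.trans ?_ h1
      simp [sq]
    rw [h2]
    push_cast
    rfl
  exact_mod_cast h

lemma norm_sq_sum_torusExp (S : Finset (ℤ × ℤ)) (a : ℤ × ℤ → ℂ) :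
    ‖∑ z ∈ S, a z • torusExp z‖ ^ 2 = (2 * Real.pi) ^ 2 * ∑ z ∈ S, ‖a z‖ ^ 2 := by
  induction S using Finset.induction_on with
  | empty => simp
  | insert z S hz ih =>
    rw [Finset.sum_insert hz, Finset.sum_insert hz, mul_add, ← ih, sq, sq ‖Finset.sum _ _‖,
      norm_add_sq_eq_norm_sq_add_norm_sq_of_inner_eq_zero (𝕜 := ℂ), ← sq, norm_smul, mul_pow,
      norm_sq_torusExp, mul_comm (‖a z‖ ^ 2)]
    rw [inner_sum]
    refine Finset.sum_eq_zero fun w hw => ?_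
    rw [inner_smul_left, inner_smul_right,
      inner_torusExp_of_ne (by rintro rfl; exact hz hw), mul_zero, mul_zero]

/-- Every `ζ` is an `L²` limit of exponentials and `tensorCLM` is continuous. The eigenfunctions of
`A` therefore need not be classified. -/
lemma eigenSpan_le_topologicalClosure_span_torusExp
    (A : L2 (volume : Measure S1) →ₗ.[ℂ] L2 (volume : Measure S1)) :
    eigenSpan A ≤ (Submodule.span ℂ (Set.range torusExp)).topologicalClosure := by
  refine Submodule.topologicalClosure_minimal _ ?_ (Submodule.isClosed_topologicalClosure _)
  rw [Submodule.span_le]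
  rintro w ⟨ν, ζ, l, -, rfl⟩
  have h : (Submodule.span ℂ (Set.range fourierL2)).topologicalClosure
      ≤ ((Submodule.span ℂ (Set.range torusExp)).topologicalClosure).comap
        (tensorCLM l).toLinearMap := by
    refine Submodule.topologicalClosure_minimal _ ?_
      ((Submodule.isClosed_topologicalClosure _).preimage (tensorCLM l).continuous)
    rw [Submodule.span_le]
    rintro _ ⟨k, rfl⟩
    exact Submodule.le_topologicalClosure _ (Submodule.subset_span ⟨(k, l), rfl⟩)
  rw [topologicalClosure_span_range_fourierL2] at h
  exact h Submodule.mem_top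

/-- A vector in the closed span of a family which is orthogonal to the members outside `Λ` is in
the closed span of the members in `Λ`, if these are orthogonal to those. -/
lemma mem_topologicalClosure_span_image {ι H : Type*} [NormedAddCommGroup H]
    [InnerProductSpace ℂ H] [CompleteSpace H] {e : ι → H} {Λ : Set ι}
    (he : ∀ i ∈ Λ, ∀ j ∉ Λ, inner ℂ (e j) (e i) = 0) {u : H}
    (hu : u ∈ (Submodule.span ℂ (Set.range e)).topologicalClosure)
    (h0 : ∀ j ∉ Λ, inner ℂ (e j) u = 0) :
    u ∈ (Submodule.span ℂ (e '' Λ)).topologicalClosure := by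
  set K := (Submodule.span ℂ (e '' Λ)).topologicalClosure with hK
  have : CompleteSpace K := (Submodule.isClosed_topologicalClosure _).completeSpace_coe
  set P := K.starProjection u
  have hP : P ∈ K := K.starProjection_apply_mem u
  -- The residual `u - P` is orthogonal to every `e j` yet lies in their closed span, so it
  -- vanishes.
  have horth (j : ι) : inner ℂ (e j) (u - P) = 0 := by
    by_cases hj : j ∈ Λ
    · have hjK : e j ∈ K :=
        Submodule.le_topologicalClosure _ (Submodule.subset_span ⟨j, hj, rfl⟩)
      rw [← inner_conj_symm, Submodule.starProjection_inner_eq_zero u _ hjK, map_zero]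
    · have hle : K ≤ (Submodule.span ℂ {e j})ᗮ := by
        refine Submodule.topologicalClosure_minimal _ ?_ (Submodule.isClosed_orthogonal _)
        rw [Submodule.span_le]
        rintro _ ⟨i, hi, rfl⟩
        exact Submodule.mem_orthogonal_singleton_iff_inner_right.2 (he i hi j hj)
      rw [inner_sub_right, h0 j hj,
        Submodule.mem_orthogonal_singleton_iff_inner_right.1 (hle hP), sub_zero]
  have hmem : u - P ∈ (Submodule.span ℂ (Set.range e)).topologicalClosure := by
    refine sub_mem hu ?_
    exact Submodule.topologicalClosure_mono (Submodule.span_mono (Set.image_subset_range _ _)) hP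
  have hle : (Submodule.span ℂ (Set.range e)).topologicalClosure
      ≤ (Submodule.span ℂ {u - P})ᗮ := by
    refine Submodule.topologicalClosure_minimal _ ?_ (Submodule.isClosed_orthogonal _)
    rw [Submodule.span_le]
    rintro _ ⟨j, rfl⟩
    exact Submodule.mem_orthogonal_singleton_iff_inner_left.2 (horth j)
  have hz : u - P = 0 :=
    inner_self_eq_zero.1 (Submodule.mem_orthogonal_singleton_iff_inner_left.1 (hle hmem))
  rwa [sub_eq_zero.1 hz]

/-- Testing `L u = 0` against a mode `(k, l)` gives `((k ^ 2) ^ m - l ^ 2)` times its coefficient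
equal to zero, so only resonant modes occur. -/
theorem mem_topologicalClosure_of_waveOperator_eq_zero (m : ℕ)
    (u : (waveOperator (opPow negLaplacian m)).domain)
    (hu : waveOperator (opPow negLaplacian m) u = 0) :
    (u : L2 ((volume : Measure S1).prod (volume : Measure S1))) ∈
      (Submodule.span ℂ (torusExp '' kernelSpectrum m)).topologicalClosure := by
  have hg := LinearPMap.mem_graph (waveOperator (opPow negLaplacian m)) u
  have hgraph : (waveOperator (opPow negLaplacian m)).graph = waveGraph (opPow negLaplacian m) :=
    Submodule.toLinearPMap_graph_eq _ (waveGraph_single_valued _)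
  rw [hu, hgraph] at hg
  obtain ⟨h1, -, h2⟩ := hg
  refine mem_topologicalClosure_span_image ?_
    (eigenSpan_le_topologicalClosure_span_torusExp _ h1) ?_
  · intro z hz w hw
    exact inner_torusExp_of_ne (by rintro rfl; exact hw hz)
  · intro z hz
    have h3 := h2 _ _ z.2 (isEigenpair_opPow (isEigenpair_negLaplacian_fourierL2 z.1) m)
    rw [inner_zero_right] at h3
    refine (mul_eq_zero.1 h3.symm).resolve_left fun h4 => hz ?_
    have h5 : ((z.2 ^ 2 : ℤ) : ℂ) = (((z.1 ^ 2) ^ m : ℤ) : ℂ) := by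
      push_cast
      push_cast at h4
      exact (sub_eq_zero.1 h4).symm
    exact_mod_cast h5

/-! ### The control property -/

lemma coeFn_sum_torusExp (S : Finset (ℤ × ℤ)) (a : ℤ × ℤ → ℂ) :
    (∑ z ∈ S, a z • torusExp z : L2 ((volume : Measure S1).prod (volume : Measure S1)))
      =ᵐ[(volume : Measure S1).prod volume]
        fun p => ∑ z ∈ S, a z * (fourier z.1 p.1 : ℂ) * (fourier z.2 p.2 : ℂ) := by
  have h : ∀ᵐ p ∂(volume : Measure S1).prod (volume : Measure S1), ∀ z : ℤ × ℤ,
      (a z • torusExp z : L2 ((volume : Measure S1).prod (volume : Measure S1))) p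
        = a z * (fourier z.1 p.1 : ℂ) * (fourier z.2 p.2 : ℂ) := by
    rw [ae_all_iff]
    intro z
    filter_upwards [Lp.coeFn_smul (a z) (torusExp z), coeFn_torusExp z] with p h1 h2
    rw [h1, Pi.smul_apply, h2, smul_eq_mul, mul_assoc]
  filter_upwards [h, Lp.coeFn_finsetSum S fun z => a z • torusExp z] with p h1 h2
  rw [h2, Finset.sum_apply]
  exact Finset.sum_congr rfl fun z _ => h1 z

/-- The integral over an open set dominates the integral over some square in the plane. -/
lemma exists_lintegral_square_le {Ω : Set (S1 × S1)} (hΩ : IsOpen Ω) (hne : Ω.Nonempty) :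
    ∃ δ : ℝ, 0 < δ ∧ δ ≤ 2 * Real.pi ∧ ∃ p q : ℝ, ∀ f : S1 × S1 → ℝ≥0∞, Measurable f →
      ∫⁻ x in Set.Ioc p (p + δ), ∫⁻ t in Set.Ioc q (q + δ), f ((x : S1), (t : S1))
        ≤ ∫⁻ z in Ω, f z ∂((volume : Measure S1).prod (volume : Measure S1)) := by
  obtain ⟨⟨X, Y⟩, hXY⟩ := hne
  obtain ⟨p, rfl⟩ := QuotientAddGroup.mk_surjective X
  obtain ⟨q, rfl⟩ := QuotientAddGroup.mk_surjective Y
  set φ : ℝ × ℝ → S1 × S1 := Prod.map (fun x : ℝ => (x : S1)) (fun t : ℝ => (t : S1)) with hφ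
  have hφc : Continuous φ :=
    (AddCircle.continuous_mk' _).prodMap (AddCircle.continuous_mk' _)
  obtain ⟨ε, hε, hball⟩ := Metric.isOpen_iff.1 (hΩ.preimage hφc) (p, q) hXY
  -- The bound `ε / 2` keeps the square in the ball; `2π` keeps it in a single fundamental domain,
  -- where the quotient map preserves measure.
  set δ := min (ε / 2) (2 * Real.pi) with hδ
  have hδ0 : 0 < δ := lt_min (by positivity) Real.two_pi_pos
  refine ⟨δ, hδ0, min_le_right _ _, p, q, fun f hf => ?_⟩
  have hsub (r : ℝ) : Set.Ioc r (r + δ) ⊆ Set.Ioc r (r + 2 * Real.pi) :=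
    Set.Ioc_subset_Ioc_right (by linarith [min_le_right (ε / 2) (2 * Real.pi)])
  have hbox : Set.Ioc p (p + δ) ×ˢ Set.Ioc q (q + δ) ⊆ φ ⁻¹' Ω := by
    refine Set.Subset.trans ?_ hball
    rintro ⟨x, t⟩ ⟨hx, ht⟩
    have hδε : δ ≤ ε / 2 := min_le_left _ _
    rw [Metric.mem_ball, Prod.dist_eq, max_lt_iff, Real.dist_eq, Real.dist_eq, abs_lt, abs_lt]
    simp only [Set.mem_Ioc] at hx ht
    exact ⟨⟨by linarith, by linarith⟩, ⟨by linarith, by linarith⟩⟩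
  have hmp : MeasurePreserving φ
      ((volume.restrict (Set.Ioc p (p + 2 * Real.pi))).prod
        (volume.restrict (Set.Ioc q (q + 2 * Real.pi))))
      ((volume : Measure S1).prod (volume : Measure S1)) :=
    (AddCircle.measurePreserving_mk (2 * Real.pi) p).prod
      (AddCircle.measurePreserving_mk (2 * Real.pi) q)
  rw [← hmp.setLIntegral_comp_preimage hΩ.measurableSet hf]
  refine le_trans (le_of_eq ?_) (lintegral_mono_set hbox)
  rw [← Measure.prod_restrict, Measure.restrict_restrict_of_subset (hsub p),
    Measure.restrict_restrict_of_subset (hsub q),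
    lintegral_prod (fun z => f (φ z)) (hf.comp hφc.measurable).aemeasurable]
  rfl

lemma exists_norm_le_restrict_of_mem_span {m : ℕ} (hm : 2 ≤ m) {Ω : Set (S1 × S1)}
    (hΩ : IsOpen Ω) (hne : Ω.Nonempty) :
    ∃ C : ℝ, 0 ≤ C ∧ ∀ v ∈ Submodule.span ℂ (torusExp '' kernelSpectrum m),
      ‖v‖ ≤ C * ‖LpToLpRestrictCLM (S1 × S1) ℂ ℂ
        ((volume : Measure S1).prod (volume : Measure S1)) 2 Ω v‖ := by
  obtain ⟨δ, hδ, hδπ, p, q, hbox⟩ := exists_lintegral_square_le hΩ hne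
  obtain ⟨C, hC, hsum⟩ := exists_sum_enorm_le_lintegral_biTrigPoly hm hδ hδπ
  -- The factor `2π` is the norm of each `torusExp`, which is not normalized.
  refine ⟨2 * Real.pi * √C, by positivity, fun v hv => ?_⟩
  obtain ⟨c, hc, rfl⟩ := (Finsupp.mem_span_image_iff_linearCombination ℂ).1 hv
  rw [Finsupp.mem_supported] at hc
  rw [Finsupp.linearCombination_apply, Finsupp.sum]
  set S := c.support
  set v := ∑ z ∈ S, c z • torusExp z with hvdef
  set r := LpToLpRestrictCLM (S1 × S1) ℂ ℂ
    ((volume : Measure S1).prod (volume : Measure S1)) 2 Ω v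
  set f : S1 × S1 → ℂ := fun p => ∑ z ∈ S, c z * (fourier z.1 p.1 : ℂ) * (fourier z.2 p.2 : ℂ)
    with hf
  have hfc : Continuous f := by
    refine continuous_finsetSum _ fun z _ => ?_
    exact (continuous_const.mul ((fourier z.1).continuous.comp continuous_fst)).mul
      ((fourier z.2).continuous.comp continuous_snd)
  have hfbi (x t : ℝ) : f ((x : S1), (t : S1)) = biTrigPoly S c x t := by
    simp only [hf, biTrigPoly, fourier_coe_eq_expI]
  have hrf : r =ᵐ[((volume : Measure S1).prod (volume : Measure S1)).restrict Ω] f :=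
    (LpToLpRestrictCLM_coeFn ℂ Ω v).trans (ae_restrict_of_ae (coeFn_sum_torusExp S c))
  have hr2 : ‖r‖ₑ ^ 2 = ∫⁻ z in Ω, ‖f z‖ₑ ^ 2
      ∂((volume : Measure S1).prod (volume : Measure S1)) := by
    have h := eLpNorm_nnreal_pow_eq_lintegral (f := f) (p := 2)
      (μ := ((volume : Measure S1).prod (volume : Measure S1)).restrict Ω) (by norm_num)
    rw [Lp.enorm_def, eLpNorm_congr_ae hrf]
    simpa using h
  have hle : ∑ z ∈ S, ‖c z‖ₑ ^ 2 ≤ ENNReal.ofReal C * ‖r‖ₑ ^ 2 := by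
    refine (hsum S c p q hc).trans ?_
    rw [hr2]
    gcongr
    refine le_trans (le_of_eq ?_) (hbox _ (hfc.enorm.measurable.pow_const 2))
    simp only [hfbi]
  have hle' : ∑ z ∈ S, ‖c z‖ ^ 2 ≤ C * ‖r‖ ^ 2 := by
    simp only [← ofReal_norm, ← ENNReal.ofReal_pow (norm_nonneg _)] at hle
    rw [← ENNReal.ofReal_mul hC, ← ENNReal.ofReal_sum_of_nonneg fun n _ => sq_nonneg _] at hle
    exact (ENNReal.ofReal_le_ofReal_iff (by positivity)).1 hle
  refine le_of_sq_le_sq ?_ (by positivity)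
  rw [hvdef, norm_sq_sum_torusExp, mul_pow (2 * Real.pi * √C), mul_pow (2 * Real.pi) (√C),
    Real.sq_sqrt hC, mul_assoc]
  exact mul_le_mul_of_nonneg_left hle' (by positivity)

/-- Restriction to `Ω` is continuous on `L²`, so the inequality defines a closed set. -/
lemma exists_norm_le_restrict_of_mem_topologicalClosure {m : ℕ} (hm : 2 ≤ m)
    {Ω : Set (S1 × S1)} (hΩ : IsOpen Ω) (hne : Ω.Nonempty) :
    ∃ C : ℝ, 0 ≤ C ∧
      ∀ v ∈ (Submodule.span ℂ (torusExp '' kernelSpectrum m)).topologicalClosure,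
        ‖v‖ ≤ C * ‖LpToLpRestrictCLM (S1 × S1) ℂ ℂ
          ((volume : Measure S1).prod (volume : Measure S1)) 2 Ω v‖ := by
  obtain ⟨C, hC, h⟩ := exists_norm_le_restrict_of_mem_span hm hΩ hne
  refine ⟨C, hC, fun v hv => ?_⟩
  have hcl : IsClosed {v : L2 ((volume : Measure S1).prod (volume : Measure S1)) |
      ‖v‖ ≤ C * ‖LpToLpRestrictCLM (S1 × S1) ℂ ℂ
        ((volume : Measure S1).prod (volume : Measure S1)) 2 Ω v‖} :=
    isClosed_le continuous_norm
      (continuous_const.mul (ContinuousLinearMap.continuous _).norm)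
  exact closure_minimal (fun v hv => h v hv) hcl hv

end GenWave

end

theorem mainTheorem11 (m : ℕ) (hm : 2 ≤ m) (Ω : Set (GenWave.S1 × GenWave.S1))
    (hΩ : IsOpen Ω) (hne : Ω.Nonempty) :
    GenWave.HasControlProperty
      (GenWave.waveOperator (GenWave.opPow GenWave.negLaplacian m)) Ω := by
  obtain ⟨C, hC, h⟩ := GenWave.exists_norm_le_restrict_of_mem_topologicalClosure hm hΩ hne
  -- `C` is only known to be nonnegative, while the control property asks for a positive constant.
  refine ⟨C + 1, by linarith, fun u hu => ?_⟩
  have h1 := h _ (GenWave.mem_topologicalClosure_of_waveOperator_eq_zero m u hu)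
  have h2 := eLpNorm_congr_ae (p := 2) (LpToLpRestrictCLM_coeFn ℂ Ω u.1)
  rw [← h2, ← Lp.enorm_def,
    ← Lp.enorm_def, ← ofReal_norm, ← ofReal_norm, ← ENNReal.ofReal_mul (by linarith)]
  refine ENNReal.ofReal_le_ofReal (h1.trans ?_)
  gcongr
  linarith
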